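/- Let $G$ be a Garside group with a fixed Garside structure $(G,P,\Delta)$ of finite type: $P\subseteq G$ is a submonoid with $P\cap P^{-1}=\{1\}$ (its elements are called positive), $\Delta\in P$, and: the partial order $a\preccurlyeq b\Leftrightarrow a^{-1}b\in P$ on $G$ is a lattice order (with greatest common divisor $\wedge$); the set $[1,\Delta]=\{a\in G: 1\preccurlyeq a\preccurlyeq\Delta\}$ of simple elements is finite and generates $G$; $\Delta^{-1}P\Delta=P$; and for each $x\in P\setminus\{1\}$ the number of factors in an expression of $x$ as a product of elements of $P\setminus\{1\}$ is bounded. For $x,\alpha\in G$ write $x^\alpha=\alpha^{-1}x\alpha$. Let $\inf(x)$ be the exponent $p$ in the left normal form $x=\Delta^p x_1\cdots x_r$ of $x$ (that is, $p\in\mathbb Z$, $r\ge 0$, each $x_i\in[1,\Delta]\setminus\{1,\Delta\}$, and $(x_i^{-1}\Delta)\wedge x_{i+1}=1$ for $1\le i<r$). Put $\iota(x)=(x\Delta^{-\inf(x)})\wedge\Delta$, $\mathfrak p(x)=\iota(x)\wedge\iota(x^{-1})$, and let $\mathfrak s(x)=x^{\mathfrak p(x)}$ be the cyclic sliding of $x$.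 Let $\mathrm{SC}(x)$ be the set of all conjugates $y$ of $x$ in $G$ such that $\mathfrak s^m(y)=y$ for some integer $m\ge 1$. Then for every $x\in G$ there is a unique positive element $c(x)$ (possibly trivial) satisfying both of the following: (1) $x^{c(x)}\in\mathrm{SC}(x)$; (2) $c(x)\preccurlyeq\alpha$ for every positive $\alpha\in G$ with $x^\alpha\in\mathrm{SC}(x)$. -/

import Mathlib

/-- The relation `a ≼ b` on a group determined by a submonoid `P`: `a⁻¹ b ∈ P`. -/
def PrefixRel {G : Type*} [Group G] (P : Submonoid G) (a b : G) : Prop :=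
  a⁻¹ * b ∈ P

/-- A Garside structure `(G, P, Δ)` on a group `G`. -/
structure GarsideStructure (G : Type*) [Group G] where
  /-- the monoid of positive elements -/
  P : Submonoid G
  /-- the Garside element -/
  Δ : G
  Δ_mem : Δ ∈ P
  /-- `P ∩ P⁻¹ = {1}` -/
  eq_one_of_mem_of_inv_mem : ∀ a : G, a ∈ P → a⁻¹ ∈ P → a = 1
  /-- any two elements have a unique least common multiple with respect to `≼` -/
  exists_lcm : ∀ a b : G, ∃! m : G, PrefixRel P a m ∧ PrefixRel P b m ∧
    ∀ c : G, PrefixRel P a c → PrefixRel P b c → PrefixRel P m c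
  /-- any two elements have a unique greatest common divisor with respect to `≼` -/
  exists_gcd : ∀ a b : G, ∃! d : G, PrefixRel P d a ∧ PrefixRel P d b ∧
    ∀ c : G, PrefixRel P c a → PrefixRel P c b → PrefixRel P c d
  /-- the set of simple elements `[1, Δ]` generates the group `G` -/
  closure_simple : Subgroup.closure {a : G | PrefixRel P 1 a ∧ PrefixRel P a Δ} = ⊤
  /-- `Δ⁻¹ P Δ = P` -/
  conj_Δ : (fun a : G => Δ⁻¹ * a * Δ) '' (P : Set G) = (P : Set G)
  /-- for `x ∈ P \ {1}`, the number of factors in decompositions of `x` into nontrivial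
  positive elements is bounded -/
  norm_finite : ∀ x ∈ P, x ≠ 1 →
    BddAbove {k : ℕ | ∃ l : List G, l.length = k ∧ (∀ a ∈ l, a ∈ P ∧ a ≠ 1) ∧ l.prod = x}

namespace GarsideStructure

variable {G : Type*} [Group G] (S : GarsideStructure G)

/-- `a ≼ b`; for positive `a`, `b` this says that `a` is a prefix of `b`. -/
def IsPrefix (a b : G) : Prop := PrefixRel S.P a b

/-- The simple elements, `[1, Δ]`. -/
def simples : Set G := {a : G | S.IsPrefix 1 a ∧ S.IsPrefix a S.Δ}

/-- The Garside structure is of finite type. -/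
def FiniteType : Prop := S.simples.Finite

/-- The greatest common divisor `a ∧ b` with respect to `≼`. -/
noncomputable def meet (a b : G) : G := (S.exists_gcd a b).choose

/-- The right complement `∂(s) = s⁻¹ Δ`. -/
def rightCompl (s : G) : G := s⁻¹ * S.Δ

/-- The decomposition `a · b` (of simple elements) is left weighted: `∂(a) ∧ b = 1`. -/
def LeftWeighted (a b : G) : Prop := S.meet (S.rightCompl a) b = 1

/-- `x = Δ ^ p * x₁ * ⋯ * xᵣ`, with `l = [x₁, …, xᵣ]`, is in left normal form. -/
def IsLeftNormalForm (x : G) (p : ℤ) (l : List G) : Prop :=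
  x = S.Δ ^ p * l.prod ∧
  (∀ s ∈ l, s ∈ S.simples ∧ s ≠ 1 ∧ s ≠ S.Δ) ∧
  l.IsChain S.LeftWeighted

/-- The infimum of `x`: the exponent `p` of `Δ` in the left normal form of `x`.
(Left normal forms exist, and they are unique unless `G` is the trivial group; in the trivial
group the exponent is arbitrary and irrelevant.) -/
noncomputable def inf (x : G) : ℤ :=
  Classical.epsilon fun p : ℤ => ∃ l : List G, S.IsLeftNormalForm x p l

/-- The initial factor `ι(x) = x Δ^{-inf(x)} ∧ Δ`. -/
noncomputable def initialFactor (x : G) : G :=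
  S.meet (x * S.Δ ^ (-S.inf x)) S.Δ

/-- The preferred prefix `𝔭(x) = ι(x) ∧ ι(x⁻¹)`. -/
noncomputable def preferredPrefix (x : G) : G :=
  S.meet (S.initialFactor x) (S.initialFactor x⁻¹)

/-- The conjugate `x^α = α⁻¹ x α`. -/
def conjBy (x α : G) : G := α⁻¹ * x * α

/-- Cyclic sliding, `𝔰(x) = x^{𝔭(x)}`. -/
noncomputable def sliding (x : G) : G := conjBy x (S.preferredPrefix x)

/-- `y` belongs to a sliding circuit: `𝔰^m(y) = y` for some `m ≥ 1`. -/
def InSlidingCircuit (y : G) : Prop := ∃ m : ℕ, 1 ≤ m ∧ S.sliding^[m] y = y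

/-- The set of sliding circuits `SC(x)`: all conjugates of `x` that belong to a sliding
circuit. -/
def SC (x : G) : Set G := {y : G | (∃ α : G, y = conjBy x α) ∧ S.InSlidingCircuit y}

end GarsideStructure

/-!
A group with a Garside structure of finite type is ordered by `≼` so that left multiplications and
right multiplications by powers of `Δ` are automorphisms. Every element lies between two powers of
`Δ`, all intervals are finite, and `inf x` is the greatest `p` with `Δ ^ p ≼ x`
(`isGreatest_inf`).

The idea is to follow sliding on conjugators. For fixed exponents `p`, `q` let
`Φ(β) = uβΔ^{-p} ∧ u⁻¹βΔ^{-q} ∧ βΔ` (`slidingMap`). This map preserves meets, it satisfies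
`Φ_u(βγ) = β Φ_{u^β}(γ)`, and `u^{Φ(β)}` is the cyclic sliding of `u^β` as long as
`p = inf (u^β)` and `q = inf ((u^β)⁻¹)`.

To keep the exponents fixed, one needs that elements of sliding circuits have maximal infimum in
their conjugacy class, and so do their inverses (`le_inf_of_inSlidingCircuit`). Let
`Ψ(β) = uβΔ^{-p} ∧ βΔ` be the analogue of `Φ` for cycling. If some conjugate of `u` has infimum
greater than `p`, then a monotonicity argument in a finite interval shows that `u` conjugated by
`Ψᵏ(1)` has this property for some `k`. If `p + q ≤ -2`, then `Φᵏ(1)` is the meet of `Ψᵏ(1)` and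
its counterpart for `u⁻¹`, and the property passes on to `Φᵏ(1)`; the remaining case is that of a
conjugate of a power of `Δ`. So sliding raises the infimum whenever that is possible
(`exists_iterate_slidingMap`).

If `u` and `u^β` belong to sliding circuits, then for a suitable `N ≥ 1` there is a `B` that
centralizes `u` with `Φᴺ(1) = B` and `Φᴺ(β) = Bβ`. As `Φ` preserves meets,
`Φᴺ(1 ∧ β) = B(1 ∧ β)`, and so `u^{1 ∧ β}` belongs to a sliding circuit. Therefore the conjugators
of `x` to sliding circuits are closed under meets (`inSlidingCircuit_conjBy_meet`). Positive ones
exist because iterated sliding takes place in a finite interval, and a nonempty set of positive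
elements that is closed under meets has a least element (`exists_least_of_meet_closed`).
-/

namespace GarsideStructure

variable {G : Type*} [Group G] (S : GarsideStructure G)

/-! ### The prefix order and its meets -/

theorem isPrefix_refl (a : G) : S.IsPrefix a a := by
  simp [IsPrefix, PrefixRel, S.P.one_mem]

variable {S} in
theorem IsPrefix.trans {a b c : G} (h₁ : S.IsPrefix a b) (h₂ : S.IsPrefix b c) :
    S.IsPrefix a c := by
  have h := S.P.mul_mem h₁ h₂
  simpa [IsPrefix, PrefixRel, mul_assoc] using h

variable {S} in
theorem IsPrefix.antisymm {a b : G} (h₁ : S.IsPrefix a b) (h₂ : S.IsPrefix b a) : a = b := by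
  have h := S.eq_one_of_mem_of_inv_mem (a⁻¹ * b) h₁ (by simpa [IsPrefix, PrefixRel] using h₂)
  exact inv_mul_eq_one.mp h

theorem one_isPrefix {a : G} : S.IsPrefix 1 a ↔ a ∈ S.P := by
  simp [IsPrefix, PrefixRel]

@[simp]
theorem mul_isPrefix_mul_left (g : G) {a b : G} :
    S.IsPrefix (g * a) (g * b) ↔ S.IsPrefix a b := by
  simp [IsPrefix, PrefixRel, mul_assoc]

theorem mul_isPrefix_iff (g : G) {a b : G} :
    S.IsPrefix (g * a) b ↔ S.IsPrefix a (g⁻¹ * b) := by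
  rw [← S.mul_isPrefix_mul_left g (b := g⁻¹ * b), mul_inv_cancel_left]

theorem conj_Δ_mem_iff {a : G} : S.Δ⁻¹ * a * S.Δ ∈ S.P ↔ a ∈ S.P := by
  constructor
  · intro h
    have h' : S.Δ⁻¹ * a * S.Δ ∈ (S.P : Set G) := h
    rw [← S.conj_Δ] at h'
    obtain ⟨b, hb, hab⟩ := h'
    have : b = a := by simpa using hab
    rwa [← this]
  · intro h
    have h' : S.Δ⁻¹ * a * S.Δ ∈ (fun a : G => S.Δ⁻¹ * a * S.Δ) '' (S.P : Set G) := ⟨a, h, rfl⟩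
    rw [S.conj_Δ] at h'
    exact h'

@[simp]
theorem mul_Δ_isPrefix_mul_Δ {a b : G} :
    S.IsPrefix (a * S.Δ) (b * S.Δ) ↔ S.IsPrefix a b := by
  rw [IsPrefix, PrefixRel, IsPrefix, PrefixRel, ← S.conj_Δ_mem_iff (a := a⁻¹ * b)]
  simp [mul_assoc]

@[simp]
theorem mul_zpow_isPrefix_mul_zpow (n : ℤ) {a b : G} :
    S.IsPrefix (a * S.Δ ^ n) (b * S.Δ ^ n) ↔ S.IsPrefix a b := by
  induction n using Int.induction_on generalizing a b with
  | zero => simp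
  | succ n ih => rw [zpow_add_one, ← mul_assoc, ← mul_assoc, mul_Δ_isPrefix_mul_Δ, ih]
  | pred n ih =>
    rw [← S.mul_Δ_isPrefix_mul_Δ, mul_assoc, mul_assoc, ← zpow_add_one, sub_add_cancel, ih]

theorem isPrefix_mul_of_mem (a : G) {b : G} (hb : b ∈ S.P) : S.IsPrefix a (a * b) := by
  simpa [IsPrefix, PrefixRel] using hb

theorem isPrefix_zpow {m n : ℤ} (h : m ≤ n) : S.IsPrefix (S.Δ ^ m) (S.Δ ^ n) := by
  obtain ⟨k, rfl⟩ := Int.le.dest h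
  rw [zpow_add, zpow_natCast]
  exact S.isPrefix_mul_of_mem _ (S.P.pow_mem S.Δ_mem k)

/-- Inversion exchanges lower bounds by powers of `Δ` with upper bounds. -/
theorem zpow_isPrefix_inv {n : ℤ} {x : G} :
    S.IsPrefix (S.Δ ^ n) x⁻¹ ↔ S.IsPrefix x (S.Δ ^ (-n)) := by
  rw [← S.mul_isPrefix_mul_left x, ← S.mul_zpow_isPrefix_mul_zpow (-n), mul_assoc, ← zpow_add]
  simp

@[simp]
theorem isPrefix_meet {a b c : G} :
    S.IsPrefix c (S.meet a b) ↔ S.IsPrefix c a ∧ S.IsPrefix c b := by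
  obtain ⟨h₁, h₂, h₃⟩ := (S.exists_gcd a b).choose_spec.1
  exact ⟨fun h => ⟨IsPrefix.trans h h₁, IsPrefix.trans h h₂⟩, fun h => h₃ c h.1 h.2⟩

theorem meet_isPrefix_left (a b : G) : S.IsPrefix (S.meet a b) a :=
  (S.isPrefix_meet.mp (S.isPrefix_refl _)).1

theorem meet_isPrefix_right (a b : G) : S.IsPrefix (S.meet a b) b :=
  (S.isPrefix_meet.mp (S.isPrefix_refl _)).2

variable {S} in
/-- Two elements with the same prefixes are equal; identities between meets are proved this
way. -/
theorem eq_of_forall_isPrefix_iff {a b : G} (h : ∀ c, S.IsPrefix c a ↔ S.IsPrefix c b) : a = b :=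
  IsPrefix.antisymm ((h a).mp (S.isPrefix_refl a)) ((h b).mpr (S.isPrefix_refl b))

theorem meet_comm (a b : G) : S.meet a b = S.meet b a :=
  eq_of_forall_isPrefix_iff (S := S) fun c => by simp [and_comm]

theorem meet_eq_left {a b : G} : S.meet a b = a ↔ S.IsPrefix a b := by
  constructor
  · intro h
    rw [← h]
    exact S.meet_isPrefix_right a b
  · intro h
    exact IsPrefix.antisymm (S.meet_isPrefix_left a b) (S.isPrefix_meet.mpr ⟨S.isPrefix_refl a, h⟩)

theorem mul_meet (g a b : G) : g * S.meet a b = S.meet (g * a) (g * b) := by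
  refine eq_of_forall_isPrefix_iff (S := S) fun c => ?_
  obtain ⟨c, rfl⟩ : ∃ d, c = g * d := ⟨g⁻¹ * c, by simp⟩
  simp

theorem meet_mul_zpow (a b : G) (n : ℤ) :
    S.meet a b * S.Δ ^ n = S.meet (a * S.Δ ^ n) (b * S.Δ ^ n) := by
  refine eq_of_forall_isPrefix_iff (S := S) fun c => ?_
  obtain ⟨c, rfl⟩ : ∃ d, c = d * S.Δ ^ n := ⟨c * (S.Δ ^ n)⁻¹, by simp⟩
  simp

theorem meet_mul_Δ (a b : G) : S.meet a b * S.Δ = S.meet (a * S.Δ) (b * S.Δ) := by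
  simpa using S.meet_mul_zpow a b 1

theorem meet_mem {a b : G} (ha : a ∈ S.P) (hb : b ∈ S.P) : S.meet a b ∈ S.P :=
  S.one_isPrefix.mp (S.isPrefix_meet.mpr ⟨S.one_isPrefix.mpr ha, S.one_isPrefix.mpr hb⟩)

/-! ### Powers of the Garside element -/

/-- Every element lies between two powers of `Δ`, because the simple elements generate. -/
theorem exists_zpow_bounds (x : G) :
    ∃ m n : ℤ, S.IsPrefix (S.Δ ^ m) x ∧ S.IsPrefix x (S.Δ ^ n) := by
  have hx : x ∈ Subgroup.closure {a : G | PrefixRel S.P 1 a ∧ PrefixRel S.P a S.Δ} := by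
    rw [S.closure_simple]
    trivial
  induction hx using Subgroup.closure_induction_right with
  | one => exact ⟨0, 0, by simp [S.isPrefix_refl], by simp [S.isPrefix_refl]⟩
  | mul_right x _ s hs ih =>
    obtain ⟨m, n, hm, hn⟩ := ih
    refine ⟨m, n + 1, hm.trans (S.isPrefix_mul_of_mem x (S.one_isPrefix.mp hs.1)), ?_⟩
    rw [zpow_add_one]
    exact IsPrefix.trans ((S.mul_isPrefix_mul_left x).mpr hs.2) (S.mul_Δ_isPrefix_mul_Δ.mpr hn)
  | mul_inv_cancel x _ s hs ih =>
    obtain ⟨m, n, hm, hn⟩ := ih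
    refine ⟨m - 1, n, ?_, ?_⟩
    · rw [← S.mul_Δ_isPrefix_mul_Δ, ← zpow_add_one, sub_add_cancel, mul_assoc]
      exact hm.trans (S.isPrefix_mul_of_mem x hs.2)
    · refine IsPrefix.trans ?_ hn
      simpa using S.isPrefix_mul_of_mem (x * s⁻¹) (S.one_isPrefix.mp hs.1)

/-- If `Δ = 1`, then `1` is the only simple element. -/
theorem subsingleton_of_Δ_eq_one (h : S.Δ = 1) : Subsingleton G := by
  refine subsingleton_of_forall_eq 1 fun x => ?_
  obtain ⟨m, n, hm, hn⟩ := S.exists_zpow_bounds x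
  rw [h, one_zpow] at hm hn
  exact hn.antisymm hm

theorem le_of_zpow_isPrefix (hΔ : S.Δ ≠ 1) {m n : ℤ} (h : S.IsPrefix (S.Δ ^ m) (S.Δ ^ n)) :
    m ≤ n := by
  by_contra! hlt
  have h₁ : S.IsPrefix (S.Δ ^ (n + 1)) (S.Δ ^ n) := (S.isPrefix_zpow hlt).trans h
  have h₂ := h₁.antisymm (S.isPrefix_zpow (by lia))
  rw [zpow_add_one] at h₂
  exact hΔ (by simpa using h₂)

theorem meet_pow_succ_isPrefix (a : G) (n : ℕ) :
    S.IsPrefix (S.meet a (S.Δ ^ (n + 1))) (S.meet a (S.Δ ^ n) * S.Δ) := by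
  rw [meet_mul_Δ, ← pow_succ, isPrefix_meet]
  refine ⟨(S.meet_isPrefix_left _ _).trans ?_, S.meet_isPrefix_right _ _⟩
  exact S.isPrefix_mul_of_mem a S.Δ_mem

/-- An element of `[1, Δⁿ⁺¹]` is the product of an element of `[1, Δⁿ]`, namely its meet with
`Δⁿ`, and a simple element. -/
theorem finite_interval_pow (hS : S.FiniteType) (n : ℕ) :
    {a : G | S.IsPrefix 1 a ∧ S.IsPrefix a (S.Δ ^ n)}.Finite := by
  induction n with
  | zero =>
    refine (Set.finite_singleton (1 : G)).subset fun a ha => ?_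
    have h₂ : S.IsPrefix a 1 := by simpa using ha.2
    exact h₂.antisymm ha.1
  | succ n ih =>
    refine (Set.Finite.image2 (fun a s => a * s) ih hS).subset ?_
    rintro a ⟨h₁, h₂⟩
    have ha := S.one_isPrefix.mp h₁
    have hm : S.meet a (S.Δ ^ (n + 1)) = a := S.meet_eq_left.mpr h₂
    refine ⟨S.meet a (S.Δ ^ n), ⟨?_, S.meet_isPrefix_right _ _⟩,
      (S.meet a (S.Δ ^ n))⁻¹ * a, ⟨?_, ?_⟩, by simp⟩
    · exact S.one_isPrefix.mpr (S.meet_mem ha (S.P.pow_mem S.Δ_mem n))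
    · rw [← S.mul_isPrefix_iff, mul_one]
      exact S.meet_isPrefix_left _ _
    · rw [← S.mul_isPrefix_mul_left (S.meet a (S.Δ ^ n)), mul_inv_cancel_left]
      simpa only [hm] using S.meet_pow_succ_isPrefix a n

theorem finite_interval (hS : S.FiniteType) (a b : G) :
    {g : G | S.IsPrefix a g ∧ S.IsPrefix g b}.Finite := by
  obtain ⟨-, n, -, hn⟩ := S.exists_zpow_bounds (a⁻¹ * b)
  refine ((S.finite_interval_pow hS n.toNat).image (fun g => a * g)).subset ?_
  rintro g ⟨h₁, h₂⟩
  refine ⟨a⁻¹ * g, ⟨?_, ?_⟩, by simp⟩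
  · rwa [← S.mul_isPrefix_iff, mul_one]
  · rw [← zpow_natCast]
    refine IsPrefix.trans ?_ (hn.trans (S.isPrefix_zpow (Int.self_le_toNat n)))
    rwa [S.mul_isPrefix_mul_left]

/-! ### Left normal forms and the infimum -/

/-- The first factor of a left weighted product of simple elements is its meet with `Δ`. -/
theorem meet_prod_Δ_of_isChain (s : G) (l : List G) (hs : ∀ t ∈ s :: l, t ∈ S.simples)
    (hl : (s :: l).IsChain S.LeftWeighted) : S.meet (s :: l).prod S.Δ = s := by
  induction l generalizing s with
  | nil =>
    simp only [List.prod_cons, List.prod_nil, mul_one]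
    exact S.meet_eq_left.mpr (hs s (by simp)).2
  | cons t l ih =>
    have ht := ih t (fun a ha => hs a (List.mem_cons_of_mem _ ha)) hl.tail
    have hst : S.LeftWeighted s t := by
      rw [List.isChain_cons_cons] at hl
      exact hl.1
    have hsP := S.one_isPrefix.mp (hs s (by simp)).1
    have hcompl : S.IsPrefix (s⁻¹ * S.Δ) S.Δ := by
      rw [← S.mul_isPrefix_mul_left s, mul_inv_cancel_left]
      have h : S.IsPrefix (1 * S.Δ) (s * S.Δ) :=
        S.mul_Δ_isPrefix_mul_Δ.mpr (S.one_isPrefix.mpr hsP)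
      simpa using h
    have h₁ : S.meet (t :: l).prod (s⁻¹ * S.Δ) = 1 := by
      rw [← hst, rightCompl]
      refine eq_of_forall_isPrefix_iff (S := S) fun c => ?_
      simp only [isPrefix_meet]
      constructor
      · rintro ⟨h₁, h₂⟩
        refine ⟨h₂, ?_⟩
        rw [← ht, isPrefix_meet]
        exact ⟨h₁, h₂.trans hcompl⟩
      · rintro ⟨h₁, h₂⟩
        rw [← ht, isPrefix_meet] at h₂
        exact ⟨h₂.1, h₁⟩
    have h₂ := S.mul_meet s (t :: l).prod (s⁻¹ * S.Δ)
    rw [h₁, mul_one, mul_inv_cancel_left] at h₂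
    rw [List.prod_cons, ← h₂]

theorem meet_Δ_inv_mul_isPrefix {x : G} {n : ℕ}
    (hn : S.IsPrefix x (S.Δ ^ (n + 1))) : S.IsPrefix ((S.meet x S.Δ)⁻¹ * x) (S.Δ ^ n) := by
  have key : ∀ i : ℕ, S.IsPrefix (S.meet x (S.Δ ^ (i + 1))) (S.meet x S.Δ * S.Δ ^ i) := by
    intro i
    induction i with
    | zero => rw [zero_add, pow_one, pow_zero, mul_one]; exact S.isPrefix_refl (S.meet x S.Δ)
    | succ i ih =>
      refine (S.meet_pow_succ_isPrefix x (i + 1)).trans ?_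
      have h := S.mul_Δ_isPrefix_mul_Δ.mpr ih
      rwa [mul_assoc, ← pow_succ] at h
  have h := key n
  rw [S.meet_eq_left.mpr hn] at h
  rwa [← S.mul_isPrefix_mul_left (S.meet x S.Δ), mul_inv_cancel_left]

/-- The left normal form of a positive element `x` starts with `x ∧ Δ`. -/
theorem exists_leftNormalForm_of_mem {x : G} (hx : x ∈ S.P)
    (hxΔ : ¬ S.IsPrefix S.Δ x) : ∃ l : List G, S.IsLeftNormalForm x 0 l := by
  obtain ⟨-, n, -, hn⟩ := S.exists_zpow_bounds x
  replace hn : S.IsPrefix x (S.Δ ^ n.toNat) := by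
    rw [← zpow_natCast]
    exact hn.trans (S.isPrefix_zpow (Int.self_le_toNat n))
  generalize n.toNat = k at hn
  induction k generalizing x with
  | zero =>
    have hx1 : x = 1 := by
      refine IsPrefix.antisymm (S := S) ?_ (S.one_isPrefix.mpr hx)
      simpa using hn
    exact ⟨[], by simp [hx1], by simp, by simp⟩
  | succ k ih =>
    by_cases hs1 : S.meet x S.Δ = 1
    · have h := S.meet_Δ_inv_mul_isPrefix hn
      rw [hs1, inv_one, one_mul] at h
      exact ih hx hxΔ h
    have hsΔ : S.meet x S.Δ ≠ S.Δ := fun h => hxΔ (h ▸ S.meet_isPrefix_left x S.Δ)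
    have hsx := S.meet_isPrefix_left x S.Δ
    have hsP : S.meet x S.Δ ∈ S.P := S.meet_mem hx S.Δ_mem
    have hss : S.meet x S.Δ ∈ S.simples := ⟨S.one_isPrefix.mpr hsP, S.meet_isPrefix_right _ _⟩
    have hsl : S.meet (S.rightCompl (S.meet x S.Δ)) ((S.meet x S.Δ)⁻¹ * x) = 1 := by
      rw [rightCompl, ← S.mul_meet, S.meet_comm S.Δ x, inv_mul_cancel]
    have hn' := S.meet_Δ_inv_mul_isPrefix hn
    generalize S.meet x S.Δ = s at *
    have hcompl : S.IsPrefix (S.rightCompl s) S.Δ := by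
      rw [rightCompl, ← S.mul_isPrefix_mul_left s, mul_inv_cancel_left]
      simpa using (S.mul_Δ_isPrefix_mul_Δ (a := 1)).mpr hss.1
    obtain ⟨l, hl₁, hl₂, hl₃⟩ := ih (x := s⁻¹ * x) hsx (fun h => by
      rw [S.meet_eq_left.mpr (hcompl.trans h)] at hsl
      exact hsΔ (inv_mul_eq_one.mp hsl)) hn'
    simp only [zpow_zero, one_mul] at hl₁
    refine ⟨s :: l, ?_, ?_, ?_⟩
    · simp [← hl₁]
    · intro t ht
      rcases List.mem_cons.mp ht with rfl | ht
      · exact ⟨hss, hs1, hsΔ⟩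
      · exact hl₂ t ht
    · cases l with
      | nil => simp
      | cons t l =>
        rw [List.isChain_cons_cons]
        refine ⟨?_, hl₃⟩
        have ht := S.meet_prod_Δ_of_isChain t l (fun a ha => (hl₂ a ha).1) hl₃
        rw [← hl₁] at ht
        rw [LeftWeighted, ← hsl]
        refine eq_of_forall_isPrefix_iff (S := S) fun c => ?_
        rw [← ht]
        simp only [isPrefix_meet]
        exact ⟨fun h => ⟨h.1, h.2.1⟩, fun h => ⟨h.1, h.2, h.1.trans hcompl⟩⟩

/-- The exponent of `Δ` in a left normal form of `x` is the greatest `p` with `Δ ^ p ≼ x`. -/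
theorem IsLeftNormalForm.isGreatest {S : GarsideStructure G} (hΔ : S.Δ ≠ 1) {x : G} {p : ℤ}
    {l : List G} (h : S.IsLeftNormalForm x p l) : IsGreatest {n : ℤ | S.IsPrefix (S.Δ ^ n) x} p := by
  obtain ⟨rfl, hl, hc⟩ := h
  have hlP : l.prod ∈ S.P := S.P.list_prod_mem fun s hs => S.one_isPrefix.mp (hl s hs).1.1
  refine ⟨S.isPrefix_mul_of_mem _ hlP, fun n hn => ?_⟩
  by_contra! hlt
  have h₁ : S.IsPrefix (S.Δ ^ (p + 1)) (S.Δ ^ p * l.prod) := (S.isPrefix_zpow hlt).trans hn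
  rw [zpow_add_one, mul_isPrefix_mul_left] at h₁
  cases l with
  | nil =>
    have h₂ : S.IsPrefix S.Δ 1 := by simpa using h₁
    exact hΔ (h₂.antisymm (S.one_isPrefix.mpr S.Δ_mem))
  | cons s l =>
    have h₂ := S.meet_prod_Δ_of_isChain s l (fun a ha => (hl a ha).1) hc
    rw [S.meet_comm, S.meet_eq_left.mpr h₁] at h₂
    exact (hl s (by simp)).2.2 h₂.symm

theorem isGreatest_inf (hΔ : S.Δ ≠ 1) (x : G) :
    IsGreatest {n : ℤ | S.IsPrefix (S.Δ ^ n) x} (S.inf x) := by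
  obtain ⟨m, n, hm, hn⟩ := S.exists_zpow_bounds x
  obtain ⟨p, hp, hmax⟩ := Int.exists_greatest_of_bdd (P := fun k => S.IsPrefix (S.Δ ^ k) x)
    ⟨n, fun k hk => S.le_of_zpow_isPrefix hΔ (IsPrefix.trans hk hn)⟩ ⟨m, hm⟩
  have hex : ∃ p : ℤ, ∃ l : List G, S.IsLeftNormalForm x p l := by
    obtain ⟨l, h₁, h₂, h₃⟩ := S.exists_leftNormalForm_of_mem (x := (S.Δ ^ p)⁻¹ * x) hp
      (fun h => by
        rw [← S.mul_isPrefix_iff, ← zpow_add_one] at h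
        have := hmax _ h
        lia)
    refine ⟨p, l, ?_, h₂, h₃⟩
    rw [zpow_zero, one_mul] at h₁
    rw [← h₁, mul_inv_cancel_left]
  obtain ⟨l, hl⟩ := Classical.epsilon_spec hex
  exact hl.isGreatest hΔ

theorem inf_eq_of_isGreatest (hΔ : S.Δ ≠ 1) {x : G} {p : ℤ}
    (h : IsGreatest {n : ℤ | S.IsPrefix (S.Δ ^ n) x} p) : S.inf x = p :=
  (S.isGreatest_inf hΔ x).unique h

/-! ### Cycling and sliding as maps on conjugators -/

/-- The map `Ψ` that sends a conjugator `β` of `u` to `β · (u^β Δ^{-p} ∧ Δ)`. For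
`p = inf (u^β)` it prolongs `β` by the initial factor of `u^β`, so that `u^{Ψ(β)}` is the cycling
of `u^β`. -/
noncomputable def cyclingMap (u : G) (p : ℤ) (β : G) : G :=
  S.meet (u * β * S.Δ ^ (-p)) (β * S.Δ)

/-- The map `Φ` that, for `p = inf (u^β)` and `q = inf ((u^β)⁻¹)`, sends a conjugator `β` of `u`
to `β · 𝔭(u^β)`. The exponents are kept as parameters, which makes the map compatible with
meets. -/
noncomputable def slidingMap (u : G) (p q : ℤ) (β : G) : G :=
  S.meet (S.cyclingMap u p β) (S.cyclingMap u⁻¹ q β)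

theorem slidingMap_inv (u : G) (p q : ℤ) : S.slidingMap u⁻¹ q p = S.slidingMap u p q := by
  funext β
  rw [slidingMap, slidingMap, inv_inv, meet_comm]

theorem cyclingMap_isPrefix (u : G) (p : ℤ) (β : G) :
    S.IsPrefix (S.cyclingMap u p β) (β * S.Δ) :=
  S.meet_isPrefix_right _ _

theorem cyclingMap_meet (u : G) (p : ℤ) (β γ : G) :
    S.cyclingMap u p (S.meet β γ) = S.meet (S.cyclingMap u p β) (S.cyclingMap u p γ) := by
  refine eq_of_forall_isPrefix_iff (S := S) fun c => ?_
  simp only [cyclingMap, mul_meet, meet_mul_zpow, meet_mul_Δ, isPrefix_meet]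
  tauto

theorem slidingMap_meet (u : G) (p q : ℤ) (β γ : G) :
    S.slidingMap u p q (S.meet β γ) = S.meet (S.slidingMap u p q β) (S.slidingMap u p q γ) := by
  refine eq_of_forall_isPrefix_iff (S := S) fun c => ?_
  simp only [slidingMap, cyclingMap_meet, isPrefix_meet]
  tauto

theorem iterate_slidingMap_meet (u : G) (p q : ℤ) (k : ℕ) (β γ : G) :
    (S.slidingMap u p q)^[k] (S.meet β γ) =
      S.meet ((S.slidingMap u p q)^[k] β) ((S.slidingMap u p q)^[k] γ) := by
  induction k with
  | zero => rfl
  | succ k ih => simp only [Function.iterate_succ_apply', ih, slidingMap_meet]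

theorem cyclingMap_mono (u : G) (p : ℤ) {β γ : G} (h : S.IsPrefix β γ) :
    S.IsPrefix (S.cyclingMap u p β) (S.cyclingMap u p γ) := by
  rw [← S.meet_eq_left] at h ⊢
  rw [← cyclingMap_meet, h]

theorem iterate_cyclingMap_mono (u : G) (p : ℤ) (k : ℕ) {β γ : G} (h : S.IsPrefix β γ) :
    S.IsPrefix ((S.cyclingMap u p)^[k] β) ((S.cyclingMap u p)^[k] γ) := by
  induction k with
  | zero => exact h
  | succ k ih =>
    simp only [Function.iterate_succ_apply']
    exact S.cyclingMap_mono u p ih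

theorem zpow_mul_Δ (n : ℤ) : S.Δ ^ n * S.Δ = S.Δ * S.Δ ^ n :=
  ((Commute.refl S.Δ).zpow_left n).eq

theorem cyclingMap_mul_zpow (u : G) (p : ℤ) (β : G) (n : ℤ) :
    S.cyclingMap u p (β * S.Δ ^ n) = S.cyclingMap u p β * S.Δ ^ n := by
  simp only [cyclingMap, meet_mul_zpow, mul_assoc, zpow_mul_Δ, ← zpow_add, add_comm]

theorem slidingMap_mul_zpow (u : G) (p q : ℤ) (β : G) (n : ℤ) :
    S.slidingMap u p q (β * S.Δ ^ n) = S.slidingMap u p q β * S.Δ ^ n := by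
  simp only [slidingMap, cyclingMap_mul_zpow, meet_mul_zpow]

theorem iterate_slidingMap_mul_zpow (u : G) (p q : ℤ) (k : ℕ) (β : G) (n : ℤ) :
    (S.slidingMap u p q)^[k] (β * S.Δ ^ n) = (S.slidingMap u p q)^[k] β * S.Δ ^ n := by
  induction k with
  | zero => rfl
  | succ k ih => simp only [Function.iterate_succ_apply', ih, slidingMap_mul_zpow]

theorem conjBy_mul (u β γ : G) : conjBy u (β * γ) = conjBy (conjBy u β) γ := by
  simp [conjBy, mul_assoc]

theorem conjBy_inv_left (u β : G) : conjBy u⁻¹ β = (conjBy u β)⁻¹ := by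
  simp [conjBy, mul_assoc]

@[simp]
theorem conjBy_one (u : G) : conjBy u 1 = u := by
  simp [conjBy]

theorem mul_conjBy (u β : G) : β * conjBy u β = u * β := by
  simp [conjBy, mul_assoc]

theorem cyclingMap_mul (u : G) (p : ℤ) (β γ : G) :
    S.cyclingMap u p (β * γ) = β * S.cyclingMap (conjBy u β) p γ := by
  rw [cyclingMap, cyclingMap, mul_meet]
  simp only [conjBy, mul_assoc, mul_inv_cancel_left]

theorem slidingMap_mul (u : G) (p q : ℤ) (β γ : G) :
    S.slidingMap u p q (β * γ) = β * S.slidingMap (conjBy u β) p q γ := by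
  rw [slidingMap, slidingMap, cyclingMap_mul, cyclingMap_mul, mul_meet, conjBy_inv_left]

theorem iterate_slidingMap_mul (u : G) (p q : ℤ) (k : ℕ) (β γ : G) :
    (S.slidingMap u p q)^[k] (β * γ) = β * (S.slidingMap (conjBy u β) p q)^[k] γ := by
  induction k with
  | zero => rfl
  | succ k ih => simp only [Function.iterate_succ_apply', ih, slidingMap_mul]

/-! ### Conjugators that respect a lower bound -/

theorem zpow_isPrefix_conjBy {n : ℤ} {u β : G} :
    S.IsPrefix (S.Δ ^ n) (conjBy u β) ↔ S.IsPrefix (β * S.Δ ^ n) (u * β) := by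
  rw [← S.mul_isPrefix_mul_left β, mul_conjBy]

/-- For each `n`, the `β` with `Δ ^ n ≼ u^β` are closed under meets. -/
theorem zpow_isPrefix_conjBy_meet {n : ℤ} {u β γ : G} (hβ : S.IsPrefix (S.Δ ^ n) (conjBy u β))
    (hγ : S.IsPrefix (S.Δ ^ n) (conjBy u γ)) :
    S.IsPrefix (S.Δ ^ n) (conjBy u (S.meet β γ)) := by
  rw [zpow_isPrefix_conjBy] at *
  rw [meet_mul_zpow, mul_meet, isPrefix_meet]
  exact ⟨(S.meet_isPrefix_left _ _).trans hβ, (S.meet_isPrefix_right _ _).trans hγ⟩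

theorem zpow_isPrefix_conjBy_cyclingMap {n p : ℤ} {u v β : G} (huv : Commute u v)
    (hβ : S.IsPrefix (S.Δ ^ n) (conjBy u β)) :
    S.IsPrefix (S.Δ ^ n) (conjBy u (S.cyclingMap v p β)) := by
  rw [zpow_isPrefix_conjBy] at hβ
  refine S.zpow_isPrefix_conjBy_meet ?_ ?_
  · rw [zpow_isPrefix_conjBy, mul_assoc (v * β), ← zpow_add, add_comm, zpow_add, ← mul_assoc,
      ← mul_assoc, mul_zpow_isPrefix_mul_zpow, ← mul_assoc, huv.eq, mul_assoc, mul_assoc,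
      mul_isPrefix_mul_left]
    exact hβ
  · rw [zpow_isPrefix_conjBy, mul_assoc, ← zpow_mul_Δ, ← mul_assoc, ← mul_assoc,
      mul_Δ_isPrefix_mul_Δ]
    exact hβ

theorem zpow_isPrefix_conjBy_slidingMap {n p q : ℤ} {u β : G}
    (hβ : S.IsPrefix (S.Δ ^ n) (conjBy u β)) :
    S.IsPrefix (S.Δ ^ n) (conjBy u (S.slidingMap u p q β)) :=
  S.zpow_isPrefix_conjBy_meet (S.zpow_isPrefix_conjBy_cyclingMap (Commute.refl u) hβ)
    (S.zpow_isPrefix_conjBy_cyclingMap (Commute.refl u).inv_right hβ)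

/-! ### Sliding raises the infimum as long as some conjugate has a larger one -/

theorem exists_eq_succ_of_antitone (hS : S.FiniteType) {a b : G} {f : ℕ → G}
    (hf : ∀ k, S.IsPrefix (f (k + 1)) (f k)) (ha : ∀ k, S.IsPrefix a (f k))
    (hb : ∀ k, S.IsPrefix (f k) b) : ∃ k, f (k + 1) = f k := by
  obtain ⟨i, j, hij, he⟩ := Set.Finite.exists_lt_map_eq_of_forall_mem (f := f)
    (t := {g : G | S.IsPrefix a g ∧ S.IsPrefix g b}) (fun k => ⟨ha k, hb k⟩) (S.finite_interval hS a b)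
  have hmono : ∀ n, S.IsPrefix (f (i + 1 + n)) (f (i + 1)) := by
    intro n
    induction n with
    | zero => exact S.isPrefix_refl _
    | succ n ih => exact (hf _).trans ih
  refine ⟨i, (hf i).antisymm ?_⟩
  have h := hmono (j - (i + 1))
  rwa [Nat.add_sub_cancel' hij, ← he] at h

/-- The conjugator `γ` can be chosen below `1` by multiplying it with a power of `Δ`. -/
theorem exists_isPrefix_one_conjBy {n : ℤ} {u γ : G} (hγ : S.IsPrefix (S.Δ ^ n) (conjBy u γ)) :
    ∃ δ : G, S.IsPrefix δ 1 ∧ S.IsPrefix (S.Δ ^ n) (conjBy u δ) := by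
  obtain ⟨-, m, -, hm⟩ := S.exists_zpow_bounds γ
  refine ⟨γ * S.Δ ^ (-m), ?_, ?_⟩
  · rw [← S.mul_zpow_isPrefix_mul_zpow m, mul_assoc, ← zpow_add]
    simpa using hm
  · rw [zpow_isPrefix_conjBy] at *
    rwa [mul_assoc, ← zpow_add, add_comm, zpow_add, ← mul_assoc, ← mul_assoc,
      mul_zpow_isPrefix_mul_zpow]

theorem succ_isPrefix_conjBy_iff {p : ℤ} {u β : G} :
    S.IsPrefix (S.Δ ^ (p + 1)) (conjBy u β) ↔ S.IsPrefix (β * S.Δ) (u * β * S.Δ ^ (-p)) := by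
  rw [zpow_isPrefix_conjBy, ← S.mul_zpow_isPrefix_mul_zpow (-p), mul_assoc, ← zpow_add]
  simp

/-- If some conjugate of `u` has infimum greater than `p`, then iterated cycling of `u` finds
one. The conjugators `Ψᵏ(1) Δ⁻ᵏ` decrease with `k`, and they stay above any `γ ≼ 1` that
conjugates `u` to an element with infimum greater than `p`; so they become stationary. -/
theorem exists_iterate_cyclingMap (hS : S.FiniteType) {p : ℤ} {u γ : G}
    (hγ : S.IsPrefix (S.Δ ^ (p + 1)) (conjBy u γ)) :
    ∃ k, S.IsPrefix (S.Δ ^ (p + 1)) (conjBy u ((S.cyclingMap u p)^[k] 1)) := by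
  obtain ⟨δ, hδ, h⟩ := S.exists_isPrefix_one_conjBy hγ
  rw [succ_isPrefix_conjBy_iff] at h
  have hfix : S.cyclingMap u p δ = δ * S.Δ := by
    rw [cyclingMap, meet_comm]
    exact S.meet_eq_left.mpr h
  have hδk : ∀ k : ℕ, (S.cyclingMap u p)^[k] δ = δ * S.Δ ^ (k : ℤ) := by
    intro k
    induction k with
    | zero => simp
    | succ k ih =>
      rw [Function.iterate_succ_apply', ih, cyclingMap_mul_zpow, hfix, mul_assoc, ← zpow_mul_Δ,
        ← zpow_add_one, Nat.cast_succ]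
  have hanti : ∀ k : ℕ, S.IsPrefix ((S.cyclingMap u p)^[k + 1] 1 * S.Δ ^ (-((k + 1 : ℕ) : ℤ)))
      ((S.cyclingMap u p)^[k] 1 * S.Δ ^ (-(k : ℤ))) := by
    intro k
    rw [← S.mul_zpow_isPrefix_mul_zpow ((k + 1 : ℕ) : ℤ), mul_assoc, mul_assoc, ← zpow_add,
      ← zpow_add, Function.iterate_succ_apply']
    simpa using S.cyclingMap_isPrefix u p ((S.cyclingMap u p)^[k] 1)
  have hle : ∀ k : ℕ, S.IsPrefix ((S.cyclingMap u p)^[k] 1 * S.Δ ^ (-(k : ℤ))) 1 := by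
    intro k
    induction k with
    | zero => simpa using S.isPrefix_refl 1
    | succ k ih => exact (hanti k).trans ih
  obtain ⟨k, hk⟩ := S.exists_eq_succ_of_antitone hS
    (f := fun k => (S.cyclingMap u p)^[k] 1 * S.Δ ^ (-(k : ℤ))) (a := δ) (b := 1) hanti
    (fun k => by
      rw [← S.mul_zpow_isPrefix_mul_zpow k, mul_assoc, ← zpow_add, neg_add_cancel, zpow_zero,
        mul_one, ← hδk]
      exact S.iterate_cyclingMap_mono u p k hδ) hle
  refine ⟨k, ?_⟩
  have h' : (S.cyclingMap u p)^[k + 1] 1 = (S.cyclingMap u p)^[k] 1 * S.Δ := by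
    have := congrArg (· * S.Δ ^ ((k + 1 : ℕ) : ℤ)) hk
    simp only [mul_assoc, ← zpow_add] at this
    simpa using this
  rw [Function.iterate_succ_apply', cyclingMap, meet_comm] at h'
  rw [succ_isPrefix_conjBy_iff]
  exact S.meet_eq_left.mp h'

/-- The estimate behind `iterate_slidingMap_one_eq`: in `u (u⁻¹ β Δ^{-q}) Δ^{-p}` the conjugating
factors cancel, and two steps `β ↦ β Δ` stay below what remains, as `-(p + q) ≥ 2`. -/
theorem meet_iterate_cyclingMap_isPrefix {p q : ℤ} (hpq : p + q ≤ -2) (u : G) (k : ℕ) :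
    S.IsPrefix (S.meet ((S.cyclingMap u p)^[k + 1] 1) ((S.cyclingMap u⁻¹ q)^[k + 1] 1))
      (u * (S.cyclingMap u⁻¹ q)^[k] 1 * S.Δ ^ (-p)) := by
  induction k with
  | zero => exact (S.meet_isPrefix_left _ _).trans (S.meet_isPrefix_left _ _)
  | succ k ih =>
    have hC := S.cyclingMap_isPrefix u p ((S.cyclingMap u p)^[k + 1] 1)
    have hK := S.cyclingMap_isPrefix u⁻¹ q ((S.cyclingMap u⁻¹ q)^[k + 1] 1)
    have hK' := S.cyclingMap_isPrefix u⁻¹ q ((S.cyclingMap u⁻¹ q)^[k] 1)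
    rw [← Function.iterate_succ_apply' (S.cyclingMap u p)] at hC
    rw [← Function.iterate_succ_apply' (S.cyclingMap u⁻¹ q)] at hK hK'
    rw [Function.iterate_succ_apply' (S.cyclingMap u⁻¹ q) k]
    rw [cyclingMap, mul_meet, meet_mul_zpow, isPrefix_meet]
    constructor
    · refine IsPrefix.trans (S.meet_isPrefix_right _ _) (hK.trans ?_)
      refine IsPrefix.trans (S.mul_Δ_isPrefix_mul_Δ.mpr hK') ?_
      rw [← mul_assoc, ← mul_assoc, mul_inv_cancel, one_mul, mul_assoc, mul_assoc, ← zpow_add,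
        mul_isPrefix_mul_left]
      have h : S.IsPrefix (S.Δ ^ (2 : ℤ)) (S.Δ ^ (-q + -p)) := S.isPrefix_zpow (by lia)
      rwa [zpow_two] at h
    · have h := S.mul_Δ_isPrefix_mul_Δ.mpr ih
      rw [meet_mul_Δ, mul_assoc (u * _), zpow_mul_Δ, ← mul_assoc, mul_assoc u] at h
      refine IsPrefix.trans ?_ h
      rw [isPrefix_meet]
      exact ⟨(S.meet_isPrefix_left _ _).trans hC, (S.meet_isPrefix_right _ _).trans hK⟩

/-- If `p + q ≤ -2` (that is, `u` has canonical length at least two when `p = inf u` and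
`q = inf u⁻¹`), then the conjugator of iterated sliding is the meet of the conjugators of iterated
cycling of `u` and of `u⁻¹`. -/
theorem iterate_slidingMap_one_eq {p q : ℤ} (hpq : p + q ≤ -2) (u : G) (k : ℕ) :
    (S.slidingMap u p q)^[k] 1 =
      S.meet ((S.cyclingMap u p)^[k] 1) ((S.cyclingMap u⁻¹ q)^[k] 1) := by
  induction k with
  | zero => exact (S.meet_eq_left.mpr (S.isPrefix_refl 1)).symm
  | succ k ih =>
    have h₁ := S.meet_iterate_cyclingMap_isPrefix hpq u k
    have h₂ := S.meet_iterate_cyclingMap_isPrefix (by rwa [add_comm] : q + p ≤ -2) u⁻¹ k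
    rw [inv_inv, meet_comm] at h₂
    rw [Function.iterate_succ_apply', ih, slidingMap_meet]
    refine eq_of_forall_isPrefix_iff (S := S) fun c => ?_
    simp only [slidingMap, isPrefix_meet, ← Function.iterate_succ_apply']
    constructor
    · exact fun h => ⟨h.1.1, h.2.2⟩
    · intro h
      have hc := S.isPrefix_meet.mpr h
      refine ⟨⟨h.1, ?_⟩, ⟨?_, h.2⟩⟩
      · refine S.isPrefix_meet.mpr ⟨hc.trans h₂, h.1.trans ?_⟩
        rw [Function.iterate_succ_apply']
        exact S.cyclingMap_isPrefix _ _ _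
      · refine S.isPrefix_meet.mpr ⟨hc.trans h₁, h.2.trans ?_⟩
        rw [Function.iterate_succ_apply']
        exact S.cyclingMap_isPrefix _ _ _

/-- A conjugate of `Δ ^ n` that is a prefix of `Δ ^ n` equals `Δ ^ n`: the sequence
`uᵏ Δ⁻ⁿᵏ` is decreasing, and it stays above every `γ ≼ 1` with `u^γ = Δ ^ n`. -/
theorem eq_zpow_of_isPrefix_of_conj (hS : S.FiniteType) {n : ℤ} {u γ : G} (hγ : S.IsPrefix γ 1)
    (h : u * γ = γ * S.Δ ^ n) (hu : S.IsPrefix u (S.Δ ^ n)) : u = S.Δ ^ n := by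
  have hf : ∀ k : ℕ, u ^ (k + 1) * (S.Δ ^ (-n)) ^ (k + 1) =
      u ^ k * (u * S.Δ ^ (-n)) * (S.Δ ^ (-n)) ^ k := by
    intro k
    rw [pow_succ u, pow_succ' (S.Δ ^ (-n))]
    simp only [mul_assoc]
  have hu' : S.IsPrefix (u * S.Δ ^ (-n)) 1 := by
    rw [← S.mul_zpow_isPrefix_mul_zpow n, mul_assoc, ← zpow_add]
    simpa using hu
  have hpow : ∀ k : ℕ, (S.Δ ^ (-n)) ^ k = S.Δ ^ (-n * k) := fun k => by
    rw [zpow_mul, zpow_natCast]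
  have hanti : ∀ k : ℕ, S.IsPrefix (u ^ (k + 1) * (S.Δ ^ (-n)) ^ (k + 1))
      (u ^ k * (S.Δ ^ (-n)) ^ k) := by
    intro k
    rw [hf, hpow, mul_zpow_isPrefix_mul_zpow]
    simpa using (S.mul_isPrefix_mul_left (u ^ k)).mpr hu'
  have hle : ∀ k : ℕ, S.IsPrefix (u ^ k * (S.Δ ^ (-n)) ^ k) 1 := by
    intro k
    induction k with
    | zero => simpa using S.isPrefix_refl 1
    | succ k ih => exact (hanti k).trans ih
  have hge : ∀ k : ℕ, S.IsPrefix γ (u ^ k * (S.Δ ^ (-n)) ^ k) := by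
    intro k
    have hk : u ^ k * γ = γ * (S.Δ ^ n) ^ k := by
      have : SemiconjBy γ (S.Δ ^ n) u := h.symm
      exact (this.pow_right k).eq.symm
    have h' : u ^ k * γ * (S.Δ ^ (-n)) ^ k = γ := by
      rw [hk, mul_assoc, zpow_neg, inv_pow, mul_inv_cancel, mul_one]
    rw [← h', hpow, mul_zpow_isPrefix_mul_zpow]
    simpa using (S.mul_isPrefix_mul_left (u ^ k)).mpr hγ
  obtain ⟨k, hk⟩ := S.exists_eq_succ_of_antitone hS
    (f := fun k => u ^ k * (S.Δ ^ (-n)) ^ k) hanti hge hle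
  have h' : u * S.Δ ^ (-n) = 1 := by
    simpa only [hf, mul_left_inj, mul_eq_left] using hk
  rwa [zpow_neg, mul_inv_eq_one] at h'

/-- If some conjugate of `u` has infimum greater than `p`, then iterated sliding of `u` finds
one. -/
theorem exists_iterate_slidingMap (hS : S.FiniteType) {p q : ℤ} {u γ : G}
    (hq : S.IsPrefix (S.Δ ^ q) u⁻¹) (hγ : S.IsPrefix (S.Δ ^ (p + 1)) (conjBy u γ)) :
    ∃ k, S.IsPrefix (S.Δ ^ (p + 1)) (conjBy u ((S.slidingMap u p q)^[k] 1)) := by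
  obtain ⟨k, hk⟩ := S.exists_iterate_cyclingMap hS hγ
  rcases le_or_gt (p + q) (-2) with hpq | hpq
  · refine ⟨k, ?_⟩
    rw [iterate_slidingMap_one_eq _ hpq]
    rw [succ_isPrefix_conjBy_iff] at *
    rw [mul_meet, meet_mul_zpow, isPrefix_meet]
    refine ⟨IsPrefix.trans (S.mul_Δ_isPrefix_mul_Δ.mpr (S.meet_isPrefix_left _ _)) hk, ?_⟩
    cases k with
    | zero =>
      refine IsPrefix.trans (S.mul_Δ_isPrefix_mul_Δ.mpr (S.meet_isPrefix_left _ _)) ?_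
      simpa using hk
    | succ k =>
      rw [Function.iterate_succ_apply' (S.cyclingMap u⁻¹ q)]
      nth_rw 2 [cyclingMap]
      rw [mul_meet, meet_mul_zpow, isPrefix_meet]
      constructor
      · refine IsPrefix.trans (S.mul_Δ_isPrefix_mul_Δ.mpr ((S.meet_isPrefix_right _ _).trans
          (S.cyclingMap_isPrefix _ _ _))) ?_
        rw [← mul_assoc, ← mul_assoc, mul_inv_cancel, one_mul, mul_assoc, mul_assoc, ← zpow_add,
          mul_isPrefix_mul_left]
        have h : S.IsPrefix (S.Δ ^ (2 : ℤ)) (S.Δ ^ (-q + -p)) := S.isPrefix_zpow (by lia)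
        rwa [zpow_two] at h
      · have h := S.mul_Δ_isPrefix_mul_Δ.mpr (S.meet_iterate_cyclingMap_isPrefix hpq u k)
        rw [Function.iterate_succ_apply' (S.cyclingMap u⁻¹ q)] at h
        rwa [mul_assoc (u * _), zpow_mul_Δ, ← mul_assoc, mul_assoc u] at h
    -- Cycling keeps the upper bound `Δ ^ (-q) ≼ Δ ^ (p + 1)` of `u`, so that the conjugate found
    -- by it is `Δ ^ (p + 1)`.
  · have hq' : ∀ k, S.IsPrefix (S.Δ ^ q) (conjBy u⁻¹ ((S.cyclingMap u p)^[k] 1)) := by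
      intro k
      induction k with
      | zero => simpa using hq
      | succ k ih =>
        rw [Function.iterate_succ_apply']
        exact S.zpow_isPrefix_conjBy_cyclingMap (Commute.refl u).inv_left ih
    have hup : ∀ {y : G}, S.IsPrefix (S.Δ ^ q) y⁻¹ → S.IsPrefix y (S.Δ ^ (p + 1)) := fun h =>
      IsPrefix.trans (S.zpow_isPrefix_inv.mp h) (S.isPrefix_zpow (by lia))
    have hk' := hq' k
    rw [conjBy_inv_left] at hk'
    have heq := (hup hk').antisymm hk
    generalize (S.cyclingMap u p)^[k] 1 = β at heq
    obtain ⟨-, m, -, hm⟩ := S.exists_zpow_bounds β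
    have h := S.eq_zpow_of_isPrefix_of_conj hS (n := p + 1) (u := u) (γ := β * S.Δ ^ (-m))
      (by
        rw [← S.mul_zpow_isPrefix_mul_zpow m, mul_assoc, ← zpow_add]
        simpa using hm)
      (by
        rw [← mul_assoc, ← mul_conjBy u β, heq]
        simp only [mul_assoc, ← zpow_add, add_comm])
      (hup hq)
    refine ⟨0, ?_⟩
    simp only [Function.iterate_zero, id_eq, conjBy_one, ← h]
    exact S.isPrefix_refl u

/-! ### Sliding circuits -/

theorem preferredPrefix_eq (y : G) :
    S.preferredPrefix y = S.slidingMap y (S.inf y) (S.inf y⁻¹) 1 := by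
  simp only [preferredPrefix, initialFactor, slidingMap, cyclingMap, mul_one, one_mul]

theorem conjBy_slidingMap {p q : ℤ} {u β : G} (hp : S.inf (conjBy u β) = p)
    (hq : S.inf (conjBy u β)⁻¹ = q) :
    conjBy u (S.slidingMap u p q β) = S.sliding (conjBy u β) := by
  have h := S.slidingMap_mul u p q β 1
  rw [mul_one] at h
  rw [h, conjBy_mul, sliding, preferredPrefix_eq, hp, hq]

theorem sliding_inv (y : G) : S.sliding y⁻¹ = (S.sliding y)⁻¹ := by
  rw [sliding, sliding, preferredPrefix, preferredPrefix, inv_inv, meet_comm, conjBy_inv_left]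

theorem iterate_sliding_inv (y : G) (k : ℕ) : S.sliding^[k] y⁻¹ = (S.sliding^[k] y)⁻¹ := by
  induction k with
  | zero => rfl
  | succ k ih => simp only [Function.iterate_succ_apply', ih, sliding_inv]

theorem inSlidingCircuit_inv {y : G} (hy : S.InSlidingCircuit y) : S.InSlidingCircuit y⁻¹ := by
  obtain ⟨m, hm, h⟩ := hy
  exact ⟨m, hm, by rw [iterate_sliding_inv, h]⟩

theorem zpow_isPrefix_sliding {n : ℤ} {y : G} (h : S.IsPrefix (S.Δ ^ n) y) :
    S.IsPrefix (S.Δ ^ n) (S.sliding y) := by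
  rw [sliding, preferredPrefix_eq]
  exact S.zpow_isPrefix_conjBy_slidingMap (by simpa using h)

theorem zpow_isPrefix_iterate_sliding {n : ℤ} {y : G} (h : S.IsPrefix (S.Δ ^ n) y) (k : ℕ) :
    S.IsPrefix (S.Δ ^ n) (S.sliding^[k] y) := by
  induction k with
  | zero => exact h
  | succ k ih =>
    rw [Function.iterate_succ_apply']
    exact S.zpow_isPrefix_sliding ih

theorem inf_le_inf_iterate_sliding (hΔ : S.Δ ≠ 1) (y : G) (k : ℕ) :
    S.inf y ≤ S.inf (S.sliding^[k] y) :=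
  (S.isGreatest_inf hΔ _).2 (S.zpow_isPrefix_iterate_sliding (S.isGreatest_inf hΔ y).1 k)

theorem inf_iterate_sliding_of_inSlidingCircuit (hΔ : S.Δ ≠ 1) {u : G}
    (hu : S.InSlidingCircuit u) (k : ℕ) : S.inf (S.sliding^[k] u) = S.inf u := by
  obtain ⟨m, hm, h⟩ := hu
  refine le_antisymm ?_ (S.inf_le_inf_iterate_sliding hΔ u k)
  have h₁ := S.inf_le_inf_iterate_sliding hΔ (S.sliding^[k] u) (k * m - k)
  have h₂ : S.sliding^[k * m] u = u := Function.IsPeriodicPt.const_mul h k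
  rwa [← Function.iterate_add_apply, Nat.sub_add_cancel (Nat.le_mul_of_pos_right k hm), h₂] at h₁

/-- An element of a sliding circuit has maximal infimum in its conjugacy class. -/
theorem le_inf_of_inSlidingCircuit (hS : S.FiniteType) (hΔ : S.Δ ≠ 1) {u : G}
    (hu : S.InSlidingCircuit u) {n : ℤ} {γ : G} (hγ : S.IsPrefix (S.Δ ^ n) (conjBy u γ)) :
    n ≤ S.inf u := by
  by_contra! hlt
  obtain ⟨k, hk⟩ := S.exists_iterate_slidingMap hS (S.isGreatest_inf hΔ u⁻¹).1
    ((S.isPrefix_zpow hlt).trans hγ)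
  have hp := S.inf_iterate_sliding_of_inSlidingCircuit hΔ hu
  have hq := S.inf_iterate_sliding_of_inSlidingCircuit hΔ (S.inSlidingCircuit_inv hu)
  have h : ∀ k, conjBy u ((S.slidingMap u (S.inf u) (S.inf u⁻¹))^[k] 1) = S.sliding^[k] u := by
    intro k
    induction k with
    | zero => simp
    | succ k ih =>
      rw [Function.iterate_succ_apply', Function.iterate_succ_apply',
        S.conjBy_slidingMap (by rw [ih, hp]) (by rw [ih, ← iterate_sliding_inv, hq]), ih]
  rw [h] at hk
  have := (S.isGreatest_inf hΔ _).2 hk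
  rw [hp] at this
  lia

theorem inf_conjBy_eq (hS : S.FiniteType) (hΔ : S.Δ ≠ 1) {u : G}
    (hu : S.InSlidingCircuit u) {γ : G} (hγ : S.IsPrefix (S.Δ ^ S.inf u) (conjBy u γ)) :
    S.inf (conjBy u γ) = S.inf u :=
  S.inf_eq_of_isGreatest hΔ ⟨hγ, fun _ h => S.le_inf_of_inSlidingCircuit hS hΔ hu h⟩

/-- The infima of an element `u` of a sliding circuit and of `u⁻¹` are maximal, so that sliding
leaves them unchanged on the conjugates of `u` which attain both; there iterated sliding is
computed by `Φ` with constant exponents. -/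
theorem conjBy_iterate_slidingMap (hS : S.FiniteType) (hΔ : S.Δ ≠ 1) {u : G}
    (hu : S.InSlidingCircuit u) {γ : G} (hp : S.IsPrefix (S.Δ ^ S.inf u) (conjBy u γ))
    (hq : S.IsPrefix (S.Δ ^ S.inf u⁻¹) (conjBy u⁻¹ γ)) (k : ℕ) :
    conjBy u ((S.slidingMap u (S.inf u) (S.inf u⁻¹))^[k] γ) = S.sliding^[k] (conjBy u γ) := by
  have hu' := S.inSlidingCircuit_inv hu
  have h : ∀ k, S.IsPrefix (S.Δ ^ S.inf u)
        (conjBy u ((S.slidingMap u (S.inf u) (S.inf u⁻¹))^[k] γ)) ∧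
      S.IsPrefix (S.Δ ^ S.inf u⁻¹)
        (conjBy u⁻¹ ((S.slidingMap u (S.inf u) (S.inf u⁻¹))^[k] γ)) := by
    intro k
    induction k with
    | zero => exact ⟨hp, hq⟩
    | succ k ih =>
      rw [Function.iterate_succ_apply']
      refine ⟨S.zpow_isPrefix_conjBy_slidingMap ih.1, ?_⟩
      rw [← slidingMap_inv] at ih ⊢
      exact S.zpow_isPrefix_conjBy_slidingMap ih.2
  induction k with
  | zero => rfl
  | succ k ih =>
    rw [Function.iterate_succ_apply', Function.iterate_succ_apply', ← ih]
    refine S.conjBy_slidingMap (S.inf_conjBy_eq hS hΔ hu (h k).1) ?_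
    rw [← conjBy_inv_left]
    exact S.inf_conjBy_eq hS hΔ hu' (h k).2

theorem iterate_slidingMap_mono (u : G) (p q : ℤ) (k : ℕ) {β γ : G} (h : S.IsPrefix β γ) :
    S.IsPrefix ((S.slidingMap u p q)^[k] β) ((S.slidingMap u p q)^[k] γ) := by
  rw [← S.meet_eq_left] at h ⊢
  rw [← iterate_slidingMap_meet, h]

/-- If `u` and `u^β` are fixed by `N`-fold sliding, then `Φᴺ(1) = B` centralizes `u` and
`Φᴺ(β) = β C` with `C` centralizing `u^β`. The elements `B⁻ʲ β Cʲ` lie in a finite interval, so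
that `β Cʲ = Bʲ β` for some `j ≥ 1`; hence `Φᴺʲ(1 ∧ β) = Bʲ (1 ∧ β)`. -/
theorem inSlidingCircuit_conjBy_one_meet (hS : S.FiniteType) (hΔ : S.Δ ≠ 1) {u β : G}
    (hu : S.InSlidingCircuit u) (hβ : S.InSlidingCircuit (conjBy u β)) :
    S.InSlidingCircuit (conjBy u (S.meet 1 β)) := by
  have hp : S.IsPrefix (S.Δ ^ S.inf u) (conjBy u β) := by
    refine IsPrefix.trans (S.isPrefix_zpow ?_) (S.isGreatest_inf hΔ _).1
    refine S.le_inf_of_inSlidingCircuit hS hΔ hβ (γ := β⁻¹) ?_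
    rw [← conjBy_mul, mul_inv_cancel, conjBy_one]
    exact (S.isGreatest_inf hΔ u).1
  have hq : S.IsPrefix (S.Δ ^ S.inf u⁻¹) (conjBy u⁻¹ β) := by
    refine IsPrefix.trans (S.isPrefix_zpow ?_) (S.isGreatest_inf hΔ _).1
    have hβ' := S.inSlidingCircuit_inv hβ
    rw [← conjBy_inv_left] at hβ'
    refine S.le_inf_of_inSlidingCircuit hS hΔ hβ' (γ := β⁻¹) ?_
    rw [← conjBy_mul, mul_inv_cancel, conjBy_one]
    exact (S.isGreatest_inf hΔ u⁻¹).1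
  have hp₁ : S.IsPrefix (S.Δ ^ S.inf u) (conjBy u 1) := by
    simpa using (S.isGreatest_inf hΔ u).1
  have hq₁ : S.IsPrefix (S.Δ ^ S.inf u⁻¹) (conjBy u⁻¹ 1) := by
    simpa using (S.isGreatest_inf hΔ u⁻¹).1
  obtain ⟨m, hm, hum⟩ := hu
  obtain ⟨n, hn, hβn⟩ := hβ
  have hu : S.InSlidingCircuit u := ⟨m, hm, hum⟩
  have huN : S.sliding^[m * n] u = u := Function.IsPeriodicPt.mul_const hum n
  have hβN : S.sliding^[m * n] (conjBy u β) = conjBy u β := Function.IsPeriodicPt.const_mul hβn m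
  have hconj := fun {γ} => S.conjBy_iterate_slidingMap hS hΔ hu (γ := γ)
  have hN : 1 ≤ m * n := Nat.mul_pos hm hn
  generalize m * n = N at huN hβN hN
  have hΦB := hconj hp₁ hq₁ N
  have hΦC := hconj hp hq N
  rw [conjBy_one, huN] at hΦB
  rw [hβN] at hΦC
  generalize hp' : S.inf u = p at *
  generalize hq' : S.inf u⁻¹ = q at *
  set B := (S.slidingMap u p q)^[N] 1 with hB
  set C := (S.slidingMap (conjBy u β) p q)^[N] 1 with hC
  have hΦβ : (S.slidingMap u p q)^[N] β = β * C := by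
    rw [hC, ← iterate_slidingMap_mul, mul_one]
  rw [hΦβ, conjBy_mul] at hΦC
  have hBpow : ∀ j, conjBy u (B ^ j) = u := by
    intro j
    induction j with
    | zero => simp
    | succ j ih => rw [pow_succ, conjBy_mul, ih, hΦB]
  have hCpow : ∀ j, conjBy (conjBy u β) (C ^ j) = conjBy u β := by
    intro j
    induction j with
    | zero => simp
    | succ j ih => rw [pow_succ, conjBy_mul, ih, hΦC]
  have h₁ : ∀ j, (S.slidingMap u p q)^[N * j] 1 = B ^ j := by
    intro j
    induction j with
    | zero => simp
    | succ j ih =>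
      rw [Nat.mul_succ, add_comm, Function.iterate_add_apply, ih, ← mul_one (B ^ j),
        iterate_slidingMap_mul, hBpow, ← hB, pow_succ]
  have h₂ : ∀ j, (S.slidingMap u p q)^[N * j] β = β * C ^ j := by
    intro j
    induction j with
    | zero => simp
    | succ j ih =>
      rw [Nat.mul_succ, add_comm, Function.iterate_add_apply, ih, ← mul_one (β * C ^ j),
        iterate_slidingMap_mul, conjBy_mul, hCpow, ← hC, mul_assoc, pow_succ]
  obtain ⟨a, b, ha, hb⟩ := S.exists_zpow_bounds β
  have hΔpow : ∀ (j : ℕ) (n : ℤ), (S.slidingMap u p q)^[N * j] (S.Δ ^ n) = B ^ j * S.Δ ^ n := by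
    intro j n
    rw [← one_mul (S.Δ ^ n), iterate_slidingMap_mul_zpow, h₁, one_mul]
  have hbound : ∀ j : ℕ, (B ^ j)⁻¹ * (β * C ^ j) ∈
      {g : G | S.IsPrefix (S.Δ ^ a) g ∧ S.IsPrefix g (S.Δ ^ b)} := by
    intro j
    have ha' := S.iterate_slidingMap_mono u p q (N * j) ha
    have hb' := S.iterate_slidingMap_mono u p q (N * j) hb
    rw [hΔpow, h₂] at ha' hb'
    refine ⟨(S.mul_isPrefix_iff _).mp ha', ?_⟩
    rwa [← S.mul_isPrefix_mul_left (B ^ j), mul_inv_cancel_left]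
  obtain ⟨i, j, hij, he⟩ := Set.Finite.exists_lt_map_eq_of_forall_mem hbound
    (S.finite_interval hS _ _)
  obtain ⟨d, rfl⟩ := Nat.exists_eq_add_of_lt hij
  have hcomm : β * C ^ (d + 1) = B ^ (d + 1) * β := by
    have he' : (B ^ i)⁻¹ * β * C ^ i =
        (B ^ i)⁻¹ * ((B ^ (d + 1))⁻¹ * (β * C ^ (d + 1))) * C ^ i := by
      rw [mul_assoc, he, add_assoc, add_comm i, pow_add B, pow_add C, mul_inv_rev]
      simp only [mul_assoc]
    rw [mul_left_inj, mul_right_inj, eq_inv_mul_iff_mul_eq] at he'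
    exact he'.symm
  refine ⟨N * (d + 1), Nat.mul_pos hN d.succ_pos, ?_⟩
  have hk := hconj (γ := S.meet 1 β) (S.zpow_isPrefix_conjBy_meet hp₁ hp)
    (S.zpow_isPrefix_conjBy_meet hq₁ hq) (N * (d + 1))
  rw [← hk, iterate_slidingMap_meet, h₁, h₂, hcomm, ← mul_one (B ^ (d + 1)), mul_assoc, one_mul,
    ← mul_meet, conjBy_mul, hBpow]

/-- The conjugators of `x` to elements of sliding circuits are closed under meets. -/
theorem inSlidingCircuit_conjBy_meet (hS : S.FiniteType) (hΔ : S.Δ ≠ 1) {x α β : G}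
    (hα : S.InSlidingCircuit (conjBy x α)) (hβ : S.InSlidingCircuit (conjBy x β)) :
    S.InSlidingCircuit (conjBy x (S.meet α β)) := by
  have h := S.inSlidingCircuit_conjBy_one_meet hS hΔ hα (β := α⁻¹ * β)
    (by rwa [← conjBy_mul, mul_inv_cancel_left])
  rwa [← conjBy_mul, mul_meet, mul_one, mul_inv_cancel_left] at h

theorem preferredPrefix_mem (hΔ : S.Δ ≠ 1) (y : G) : S.preferredPrefix y ∈ S.P := by
  have h : ∀ y, S.initialFactor y ∈ S.P := by
    intro y
    refine S.meet_mem (S.one_isPrefix.mp ?_) S.Δ_mem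
    rw [← S.mul_zpow_isPrefix_mul_zpow (S.inf y), mul_assoc, ← zpow_add]
    simpa using (S.isGreatest_inf hΔ y).1
  exact S.meet_mem (h y) (h y⁻¹)

/-- Iterated sliding of `x` stays in a finite interval, and so it reaches a sliding circuit. -/
theorem exists_mem_inSlidingCircuit (hS : S.FiniteType) (hΔ : S.Δ ≠ 1) (x : G) :
    ∃ α ∈ S.P, S.InSlidingCircuit (conjBy x α) := by
  have hconj : ∀ k, ∃ α ∈ S.P, conjBy x α = S.sliding^[k] x := by
    intro k
    induction k with
    | zero => exact ⟨1, S.P.one_mem, conjBy_one x⟩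
    | succ k ih =>
      obtain ⟨α, hα, h⟩ := ih
      refine ⟨α * S.preferredPrefix (S.sliding^[k] x),
        S.P.mul_mem hα (S.preferredPrefix_mem hΔ _), ?_⟩
      rw [conjBy_mul, h, Function.iterate_succ_apply', sliding]
  obtain ⟨i, j, hij, he⟩ := Set.Finite.exists_lt_map_eq_of_forall_mem
    (f := fun k => S.sliding^[k] x)
    (t := {g : G | S.IsPrefix (S.Δ ^ S.inf x) g ∧ S.IsPrefix g (S.Δ ^ (-S.inf x⁻¹))})
    (fun k => ⟨S.zpow_isPrefix_iterate_sliding (S.isGreatest_inf hΔ x).1 k, by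
      rw [← zpow_isPrefix_inv, ← iterate_sliding_inv]
      exact S.zpow_isPrefix_iterate_sliding (S.isGreatest_inf hΔ x⁻¹).1 k⟩)
    (S.finite_interval hS _ _)
  obtain ⟨α, hα, h⟩ := hconj i
  refine ⟨α, hα, j - i, Nat.sub_pos_of_lt hij, ?_⟩
  rw [h, ← Function.iterate_add_apply, Nat.sub_add_cancel hij.le]
  exact he.symm

/-- A nonempty set of positive elements that is closed under meets has a least element: the meet
of its finitely many elements below a given one. -/
theorem exists_least_of_meet_closed (hS : S.FiniteType) {A : Set G} (hA : A.Nonempty)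
    (hP : A ⊆ S.P) (hmeet : ∀ a ∈ A, ∀ b ∈ A, S.meet a b ∈ A) :
    ∃ c ∈ A, ∀ a ∈ A, S.IsPrefix c a := by
  obtain ⟨a₀, ha₀⟩ := hA
  have hlow : ∀ T : Set G, T.Finite → T ⊆ A → ∃ c ∈ A, ∀ a ∈ T, S.IsPrefix c a := by
    intro T hT
    induction T, hT using Set.Finite.induction_on with
    | empty => exact fun _ => ⟨a₀, ha₀, by simp⟩
    | @insert b T _ _ ih =>
      intro hsub
      obtain ⟨c, hc, h⟩ := ih fun a ha => hsub (Set.mem_insert_of_mem b ha)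
      refine ⟨S.meet b c, hmeet b (hsub (Set.mem_insert b T)) c hc, ?_⟩
      rintro a (rfl | ha)
      · exact S.meet_isPrefix_left _ _
      · exact (S.meet_isPrefix_right _ _).trans (h a ha)
  obtain ⟨c, hc, h⟩ := hlow {a ∈ A | S.IsPrefix a a₀}
    ((S.finite_interval hS 1 a₀).subset fun a ha => ⟨S.one_isPrefix.mpr (hP ha.1), ha.2⟩)
    fun a ha => ha.1
  exact ⟨c, hc, fun a ha =>
    (h _ ⟨hmeet a ha a₀ ha₀, S.meet_isPrefix_right _ _⟩).trans (S.meet_isPrefix_left _ _)⟩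

end GarsideStructure

theorem mainTheorem8 {G : Type*} [Group G] (S : GarsideStructure G) (hS : S.FiniteType)
    (x : G) :
    ∃! c : G, c ∈ S.P ∧ GarsideStructure.conjBy x c ∈ S.SC x ∧
      ∀ α : G, α ∈ S.P → GarsideStructure.conjBy x α ∈ S.SC x → S.IsPrefix c α := by
  have hex : ∃ c ∈ S.P, S.InSlidingCircuit (GarsideStructure.conjBy x c) ∧
      ∀ α ∈ S.P, S.InSlidingCircuit (GarsideStructure.conjBy x α) → S.IsPrefix c α := by
    by_cases hΔ : S.Δ = 1
    · have := S.subsingleton_of_Δ_eq_one hΔ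
      refine ⟨1, S.P.one_mem, ⟨1, le_rfl, Subsingleton.elim _ _⟩, fun α hα _ => ?_⟩
      exact S.one_isPrefix.mpr hα
    · obtain ⟨c, hc, h⟩ := S.exists_least_of_meet_closed hS
        (A := {α | α ∈ S.P ∧ S.InSlidingCircuit (GarsideStructure.conjBy x α)})
        (S.exists_mem_inSlidingCircuit hS hΔ x) (fun _ h => h.1)
        (fun a ha b hb => ⟨S.meet_mem ha.1 hb.1,
          S.inSlidingCircuit_conjBy_meet hS hΔ ha.2 hb.2⟩)
      exact ⟨c, hc.1, hc.2, fun α h₁ h₂ => h α ⟨h₁, h₂⟩⟩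
  obtain ⟨c, hcP, hc, hmin⟩ := hex
  refine ⟨c, ⟨hcP, ⟨⟨c, rfl⟩, hc⟩, fun α hα h => hmin α hα h.2⟩, ?_⟩
  rintro d ⟨hdP, hd, hdmin⟩
  exact (hdmin c hcP ⟨⟨c, rfl⟩, hc⟩).antisymm (hmin d hdP hd.2)
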